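/- Let $(X_{\mathbb R},\|\cdot\|)$ be a separable real Banach space and let $X = X_{\mathbb R}\oplus iX_{\mathbb R}$ be its complexification, with the norm $\|x\|=\sup_{0\le\theta<2\pi}\|\operatorname{Re}(e^{i\theta}x)\|$; regard $X_{\mathbb R}\subset X$. An open set $P\subset X$ is called pseudoconvex if $-\log\operatorname{dist}(x,\partial P)$ is plurisubharmonic in $P$ (that is, upper semicontinuous with values in $[-\infty,\infty)$ and satisfying the sub-mean value inequality on every closed complex affine disc contained in $P$; if $\partial P=\emptyset$ the function is $\equiv-\infty$, which is allowed). Let $\Omega\subset X_{\mathbb R}$ be open. Then there is a pseudoconvex open set $P\subset X$ such that $P\cap X_{\mathbb R}=\Omega$. Moreover, if $\emptyset\ne\Omega\ne X_{\mathbb R}$, then $P$ can be chosen in the following form. There are a sequence $(a_k)_{k\ge 0}$ in $\Omega$ that is dense in $\Omega$ and, for every $k\ge 0$ and $b\in X_{\mathbb R}\setminus\Omega$, a continuous real linear functional $l_{a_kb}$ on $X_{\mathbb R}$ of norm $1$ with $l_{a_kb}(a_k-b)=\|a_k-b\|$, extended to $X$ by $l_{a_kb}(x)=l_{a_kb}(\operatorname{Re}x)+i\,l_{a_kb}(\operatorname{Im}x)$,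 such that for every $b\in X_{\mathbb R}\setminus\Omega$ the series $$\phi_b(x)=\sum_{k=0}^\infty 4^{-k}\bigl(l_{a_kb}(x-b)\bigr)^2$$ converges for all $x\in X$ and defines an entire function on $X$, the supremum $u(x)=\sup_{b\in X_{\mathbb R}\setminus\Omega}\bigl(-\operatorname{Re}\phi_b(x)\bigr)$ is finite for all $x\in X$, and $P=\{x\in X: u(x)<0\}$. -/

import Mathlib

noncomputable section

/-- The complexification `X = E ⊕ iE` of a real vector space `E`. -/
@[ext]
structure Complexification (E : Type*) where
  /-- The real part. -/
  re : E
  /-- The imaginary part. -/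
  im : E

namespace Complexification

section Algebra

variable {E : Type*} [AddCommGroup E]

instance : Zero (Complexification E) := ⟨⟨0, 0⟩⟩
instance : Add (Complexification E) := ⟨fun x y => ⟨x.re + y.re, x.im + y.im⟩⟩
instance : Neg (Complexification E) := ⟨fun x => ⟨-x.re, -x.im⟩⟩

@[simp] theorem zero_re : (0 : Complexification E).re = 0 := rfl
@[simp] theorem zero_im : (0 : Complexification E).im = 0 := rfl
@[simp] theorem add_re (x y : Complexification E) : (x + y).re = x.re + y.re := rfl
@[simp] theorem add_im (x y : Complexification E) : (x + y).im = x.im + y.im := rfl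
@[simp] theorem neg_re (x : Complexification E) : (-x).re = -x.re := rfl
@[simp] theorem neg_im (x : Complexification E) : (-x).im = -x.im := rfl

instance : AddCommGroup (Complexification E) where
  add_assoc x y z := by ext <;> simp [add_assoc]
  zero_add x := by ext <;> simp
  add_zero x := by ext <;> simp
  add_comm x y := by ext <;> simp [add_comm]
  neg_add_cancel x := by ext <;> simp
  nsmul := nsmulRec
  zsmul := zsmulRec

/-- The inclusion of the real space as the real points of its complexification. -/
def ofReal (x : E) : Complexification E := ⟨x, 0⟩

variable [Module ℝ E]

/-- `(α + iβ)(x₁ + i x₂) = (α x₁ - β x₂) + i (β x₁ + α x₂)`. -/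
instance : SMul ℂ (Complexification E) :=
  ⟨fun c x => ⟨c.re • x.re - c.im • x.im, c.im • x.re + c.re • x.im⟩⟩

@[simp] theorem smul_re (c : ℂ) (x : Complexification E) :
    (c • x).re = c.re • x.re - c.im • x.im := rfl
@[simp] theorem smul_im (c : ℂ) (x : Complexification E) :
    (c • x).im = c.im • x.re + c.re • x.im := rfl

instance : Module ℂ (Complexification E) where
  one_smul x := by ext <;> simp
  mul_smul a b x := by ext <;> simp <;> module
  smul_zero a := by ext <;> simp
  smul_add a x y := by ext <;> simp <;> module
  add_smul a b x := by ext <;> simp <;> module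
  zero_smul x := by ext <;> simp

end Algebra

section Norm

variable {E : Type*} [NormedAddCommGroup E] [NormedSpace ℝ E]

/-- The norm `‖x‖ = sup_θ ‖Re (e^{iθ} x)‖`; here `z = e^{iθ}` runs through the unit circle. -/
instance : Norm (Complexification E) :=
  ⟨fun x => ⨆ z : Circle, ‖((z : ℂ) • x).re‖⟩

theorem norm_def (x : Complexification E) :
    ‖x‖ = ⨆ z : Circle, ‖((z : ℂ) • x).re‖ := rfl

theorem bddAbove_norm (x : Complexification E) :
    BddAbove (Set.range fun z : Circle => ‖((z : ℂ) • x).re‖) := by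
  refine ⟨‖x.re‖ + ‖x.im‖, ?_⟩
  rintro _ ⟨z, rfl⟩
  have h1 : |(z : ℂ).re| ≤ 1 := (Complex.abs_re_le_norm _).trans z.norm_coe.le
  have h2 : |(z : ℂ).im| ≤ 1 := (Complex.abs_im_le_norm _).trans z.norm_coe.le
  calc ‖(z : ℂ).re • x.re - (z : ℂ).im • x.im‖
      ≤ ‖(z : ℂ).re • x.re‖ + ‖(z : ℂ).im • x.im‖ := norm_sub_le _ _
    _ = |(z : ℂ).re| * ‖x.re‖ + |(z : ℂ).im| * ‖x.im‖ := by simp [norm_smul]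
    _ ≤ 1 * ‖x.re‖ + 1 * ‖x.im‖ := by gcongr
    _ = ‖x.re‖ + ‖x.im‖ := by ring

theorem norm_re_smul_le (x : Complexification E) (z : Circle) :
    ‖((z : ℂ) • x).re‖ ≤ ‖x‖ := le_ciSup (bddAbove_norm x) z

theorem norm_core : NormedSpace.Core ℂ (Complexification E) where
  norm_nonneg x := Real.iSup_nonneg fun _ => norm_nonneg _
  norm_smul c x := by
    obtain ⟨w, hw⟩ : ∃ w : Circle, c = (‖c‖ : ℂ) * w :=
      ⟨Circle.exp c.arg, by simp [Circle.coe_exp, Complex.norm_mul_exp_arg_mul_I]⟩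
    have key : ∀ z : Circle,
        ‖((z : ℂ) • (c • x)).re‖ = ‖c‖ * ‖(((z * w : Circle) : ℂ) • x).re‖ := by
      intro z
      have : (z : ℂ) • (c • x) = (‖c‖ : ℂ) • (((z * w : Circle) : ℂ) • x) := by
        rw [smul_smul, smul_smul]
        congr 1
        conv_lhs => rw [hw]
        push_cast
        ring
      rw [this, smul_re]
      simp [-smul_re, norm_smul]
    rw [norm_def, norm_def, Real.mul_iSup_of_nonneg (norm_nonneg c)]
    simp_rw [key]
    exact (Equiv.mulRight w).iSup_comp (g := fun z : Circle => ‖c‖ * ‖((z : ℂ) • x).re‖)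
  norm_triangle x y := by
    refine ciSup_le fun z => ?_
    rw [smul_add, add_re]
    exact (norm_add_le _ _).trans (add_le_add (norm_re_smul_le x z) (norm_re_smul_le y z))
  norm_eq_zero_iff x := by
    constructor
    · intro h
      have h1 := norm_re_smul_le x 1
      have h2 := norm_re_smul_le x (Circle.exp (Real.pi / 2))
      rw [h] at h1 h2
      ext
      · simpa using h1
      · simpa [Circle.coe_exp, Complex.exp_re, Complex.exp_im] using h2
    · rintro rfl
      simp [norm_def]

instance : NormedAddCommGroup (Complexification E) := NormedAddCommGroup.ofCore norm_core

instance : NormedSpace ℂ (Complexification E) := NormedSpace.ofCore norm_core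

/-- The complex linear extension `x ↦ l (Re x) + i l (Im x)` of a real linear functional `l`. -/
def extend (l : E →L[ℝ] ℝ) (x : Complexification E) : ℂ :=
  (l x.re : ℂ) + Complex.I * (l x.im : ℂ)

end Norm

end Complexification

section Pseudoconvex

variable {X : Type*} [NormedAddCommGroup X] [NormedSpace ℂ X]

/-- The mean value `(2π)⁻¹ ∫₀^{2π} u (a + e^{iθ} b) dθ` of an extended real valued function,
as the mean of the positive part minus the mean of the negative part. For functions bounded above
on the circle the first mean is finite, and the difference is the usual mean in `[-∞, ∞)`. -/
def circleMean (u : X → EReal) (a b : X) : EReal :=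
  ((ENNReal.ofReal (2 * Real.pi)⁻¹ * ∫⁻ θ in Set.Ioc (0 : ℝ) (2 * Real.pi),
      (u (a + Complex.exp (θ * Complex.I) • b)).toENNReal : ENNReal) : EReal) -
    ((ENNReal.ofReal (2 * Real.pi)⁻¹ * ∫⁻ θ in Set.Ioc (0 : ℝ) (2 * Real.pi),
      (-u (a + Complex.exp (θ * Complex.I) • b)).toENNReal : ENNReal) : EReal)

/-- `u : P → [-∞, ∞)` is plurisubharmonic on `P`: it is upper semicontinuous and satisfies the
sub-mean value inequality on every closed complex disc `{a + ζ b : |ζ| ≤ 1}` contained in `P`.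
The function identically `-∞` is allowed. -/
structure PlurisubharmonicOn (u : X → EReal) (P : Set X) : Prop where
  lt_top : ∀ x ∈ P, u x < ⊤
  upperSemicontinuousOn : UpperSemicontinuousOn u P
  le_circleMean : ∀ a b : X, (∀ ζ : ℂ, ‖ζ‖ ≤ 1 → a + ζ • b ∈ P) → u a ≤ circleMean u a b

/-- An open set `P` is pseudoconvex if `-log dist(x, ∂P)` is plurisubharmonic in `P`. If `∂P` is
empty, the distance is `∞` and the function is identically `-∞`. -/
structure IsPseudoconvex (P : Set X) : Prop where
  isOpen : IsOpen P
  plurisubharmonicOn :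
    PlurisubharmonicOn (fun x => -ENNReal.log (Metric.infEDist x (frontier P))) P

end Pseudoconvex

end

open MeasureTheory Metric Set Filter Topology

/-! For real `x` the number `-Re φ_b(x)` is minus a weighted sum of squares. It vanishes at `x = b`,
so `u ≥ 0` off `Ω`. If `x ∈ Ω`, one `a_k` close to `x` makes a single term positive, bounded below
uniformly in `b`, so `u(x) < 0`. Hence `{u < 0}` meets the real space exactly in `Ω`.
Pseudoconvexity (`isPseudoconvex_setOf_iSup_re_lt`) is a disc argument: were the sub-mean value
inequality for `-log dist` to fail, there would be an analytic disc with boundary in `P` and centre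
on `∂P`, against the maximum principle for the functions `-Re φ_b`. Besides finiteness of `u`, this
needs its upper semicontinuity, which rests on the increment bound `neg_re_le_of_dist_le`, uniform
in `b`. -/

/-! ### Harmonic functions on the unit circle. -/

/-- Every continuous real function on the unit circle is uniformly approximated there by real
parts of entire functions. -/
theorem exists_differentiable_re_near {g : ℂ → ℝ} (hg : ContinuousOn g (sphere 0 1)) {ε : ℝ}
    (hε : 0 < ε) :
    ∃ p : ℂ → ℂ, Differentiable ℂ p ∧ ∀ z ∈ sphere (0 : ℂ) 1, |g z - (p z).re| < ε := by
  have : Fact (0 < 2 * Real.pi) := ⟨Real.two_pi_pos⟩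
  have hmem : ∀ x : AddCircle (2 * Real.pi), ((AddCircle.toCircle x : Circle) : ℂ) ∈
      sphere (0 : ℂ) 1 := fun x => by
    rw [mem_sphere_zero_iff_norm, Circle.norm_coe]
  let G : C(AddCircle (2 * Real.pi), ℂ) :=
    ⟨fun x => (g (AddCircle.toCircle x) : ℂ), Complex.continuous_ofReal.comp
      (hg.comp_continuous (continuous_subtype_val.comp AddCircle.continuous_toCircle) hmem)⟩
  have hG : G ∈ (Submodule.span ℂ (range <| @fourier (2 * Real.pi))).topologicalClosure := by
    rw [span_fourier_closure_eq_top]; trivial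
  obtain ⟨q, hq, hqG⟩ := Metric.mem_closure_iff.1 hG ε hε
  -- On the circle `z⁻¹` is the conjugate of `z`, so negative frequencies are conjugates of
  -- polynomials; conjugation is harmless, as only the real part matters.
  have key : ∃ p₁ p₂ : ℂ → ℂ, Differentiable ℂ p₁ ∧ Differentiable ℂ p₂ ∧
      ∀ x, q x = p₁ (AddCircle.toCircle x) + star (p₂ (AddCircle.toCircle x)) := by
    clear hqG
    change q ∈ Submodule.span ℂ (range <| @fourier (2 * Real.pi)) at hq
    induction hq using Submodule.span_induction with
    | mem f hf =>
      obtain ⟨n, rfl⟩ := hf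
      obtain ⟨m, rfl | rfl⟩ := n.eq_nat_or_neg
      · refine ⟨fun z => z ^ m, 0, by fun_prop, by fun_prop, fun x => ?_⟩
        simp [fourier_apply, AddCircle.toCircle_nsmul]
      · refine ⟨0, fun z => z ^ m, by fun_prop, by fun_prop, fun x => ?_⟩
        simp [fourier_apply, AddCircle.toCircle_nsmul, AddCircle.toCircle_neg,
          ← Circle.coe_inv_eq_conj]
    | zero => exact ⟨0, 0, by fun_prop, by fun_prop, by simp⟩
    | add f h _ _ hf hh =>
      obtain ⟨p₁, p₂, h₁, h₂, hp⟩ := hf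
      obtain ⟨q₁, q₂, k₁, k₂, hq⟩ := hh
      refine ⟨p₁ + q₁, p₂ + q₂, h₁.add k₁, h₂.add k₂, fun x => ?_⟩
      simp only [ContinuousMap.add_apply, hp, hq, Pi.add_apply, star_add]
      ring
    | smul c f _ hf =>
      obtain ⟨p₁, p₂, h₁, h₂, hp⟩ := hf
      refine ⟨c • p₁, star c • p₂, h₁.const_smul c, h₂.const_smul _, fun x => ?_⟩
      simp only [ContinuousMap.smul_apply, hp, Pi.smul_apply, smul_eq_mul, star_mul', star_star]
      ring
  obtain ⟨p₁, p₂, h₁, h₂, hp⟩ := key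
  refine ⟨p₁ + p₂, h₁.add h₂, fun z hz => ?_⟩
  obtain ⟨x, hx⟩ : ∃ x : AddCircle (2 * Real.pi), ((AddCircle.toCircle x : Circle) : ℂ) = z := by
    refine ⟨((z.arg : ℝ) : AddCircle (2 * Real.pi)), ?_⟩
    have hz' : ‖z‖ = 1 := by simpa using hz
    rw [AddCircle.toCircle_apply_mk, Circle.coe_exp]
    simpa [hz'] using Complex.norm_mul_exp_arg_mul_I z
  have h := (ContinuousMap.dist_lt_iff hε).1 hqG x
  rw [Complex.dist_eq] at h
  have h' := (Complex.abs_re_le_norm _).trans_lt h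
  simpa [G, hp, hx] using h'

theorem circleIntegrable_re {p : ℂ → ℂ} (hp : Differentiable ℂ p) :
    CircleIntegrable (fun z => (p z).re) 0 1 :=
  (Complex.continuous_re.comp hp.continuous).continuousOn.circleIntegrable zero_le_one

/-- The mean value property of the real part of an entire function. -/
theorem circleAverage_re {p : ℂ → ℂ} (hp : Differentiable ℂ p) :
    Real.circleAverage (fun z => (p z).re) 0 1 = (p 0).re := by
  have h := hp.diffContOnCl.circleAverage (R := 1) (c := 0)
  have h' := Complex.reCLM.circleAverage_comp_comm
    (hp.continuous.continuousOn.circleIntegrable (c := 0) zero_le_one)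
  rw [h] at h'
  exact h'

/-- On continuous real functions `circleMean` is the circle average. -/
theorem circleMean_eq_circleAverage {X : Type*} [NormedAddCommGroup X] [NormedSpace ℂ X]
    {u : X → EReal} {g : ℂ → ℝ} {a b : X} (hg : ContinuousOn g (sphere 0 1))
    (hu : ∀ ζ ∈ sphere (0 : ℂ) 1, u (a + ζ • b) = g ζ) :
    circleMean u a b = (Real.circleAverage g 0 1 : ℝ) := by
  have hmem : ∀ θ : ℝ, Complex.exp (θ * Complex.I) ∈ sphere (0 : ℂ) 1 := fun θ => by
    simp [Complex.norm_exp_ofReal_mul_I]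
  have hc : Continuous fun θ : ℝ => g (Complex.exp (θ * Complex.I)) :=
    hg.comp_continuous (by fun_prop) hmem
  have hi : Integrable (fun θ : ℝ => g (Complex.exp (θ * Complex.I)))
      (volume.restrict (Ioc 0 (2 * Real.pi))) :=
    (hc.integrableOn_Icc (a := 0) (b := 2 * Real.pi)).mono_set Ioc_subset_Icc_self
  have hpos := (hi.lintegral_lt_top).ne
  have hneg := (hi.neg.lintegral_lt_top).ne
  have h2 : (0 : ℝ) ≤ (2 * Real.pi)⁻¹ := by positivity
  have e1 : ∀ θ : ℝ, (u (a + Complex.exp (θ * Complex.I) • b)).toENNReal =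
      ENNReal.ofReal (g (Complex.exp (θ * Complex.I))) := fun θ => by
    rw [hu _ (hmem θ)]; rfl
  have e2 : ∀ θ : ℝ, (-u (a + Complex.exp (θ * Complex.I) • b)).toENNReal =
      ENNReal.ofReal (-g (Complex.exp (θ * Complex.I))) := fun θ => by
    rw [hu _ (hmem θ)]; rfl
  have hav : Real.circleAverage g 0 1 = (2 * Real.pi)⁻¹ *
      ∫ θ in Ioc (0 : ℝ) (2 * Real.pi), g (Complex.exp (θ * Complex.I)) := by
    rw [Real.circleAverage_def, intervalIntegral.integral_of_le Real.two_pi_pos.le]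
    simp [circleMap]
  rw [circleMean, hav, integral_eq_lintegral_pos_part_sub_lintegral_neg_part hi]
  simp_rw [e1, e2]
  simp only [Pi.neg_apply] at hneg
  rw [← ENNReal.ofReal_toReal hpos, ← ENNReal.ofReal_toReal hneg, ← ENNReal.ofReal_mul h2,
    ← ENNReal.ofReal_mul h2, EReal.coe_ennreal_ofReal, EReal.coe_ennreal_ofReal,
    max_eq_left (by positivity), max_eq_left (by positivity), ← EReal.coe_sub,
    ENNReal.toReal_ofReal (by positivity), ENNReal.toReal_ofReal (by positivity), mul_sub]

/-- An upper bound for the real part of an entire function on the unit circle holds at `0`. -/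
theorem re_zero_le_of_sphere {p : ℂ → ℂ} (hp : Differentiable ℂ p) {M : ℝ}
    (h : ∀ z ∈ sphere (0 : ℂ) 1, (p z).re ≤ M) : (p 0).re ≤ M := by
  rw [← circleAverage_re hp]
  exact Real.circleAverage_mono_on_of_le_circle (circleIntegrable_re hp) (by simpa using h)

/-! ### Pseudoconvexity of sublevel sets. -/

section Sublevel

variable {X : Type*} [NormedAddCommGroup X] [NormedSpace ℂ X]

/-- A segment from `x` that leaves `P` crosses the frontier no farther from `x` than its endpoint.
-/
theorem mem_of_ofReal_lt_infEDist_frontier {P : Set X} (hP : IsOpen P) {x y : X}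
    (hx : x ∈ P) (h : ENNReal.ofReal ‖y - x‖ < infEDist x (frontier P)) : y ∈ P := by
  let _ : NormedSpace ℝ X := NormedSpace.restrictScalars ℝ ℂ X
  by_contra hy
  obtain ⟨z, hz, hzf⟩ : (segment ℝ x y ∩ frontier P).Nonempty := by
    by_contra hemp
    have hsep : ∀ z ∈ segment ℝ x y, z ∈ closure P → z ∈ P := fun z hz hzc => by
      by_contra hzP
      exact hemp ⟨z, hz, by rw [hP.frontier_eq]; exact ⟨hzc, hzP⟩⟩
    obtain ⟨z, -, hz₁, hz₂⟩ := (convex_segment x y).isPreconnected P (closure P)ᶜ hP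
      isClosed_closure.isOpen_compl (fun z hz => or_iff_not_imp_right.2 fun h =>
        hsep z hz (not_not.1 h)) ⟨x, left_mem_segment ℝ x y, hx⟩
      ⟨y, right_mem_segment ℝ x y, fun h => hy (hsep y (right_mem_segment ℝ x y) h)⟩
    exact hz₂ (subset_closure hz₁)
  refine absurd h (not_lt.2 ((infEDist_le_edist_of_mem hzf).trans ?_))
  rw [edist_dist, dist_eq_norm]
  refine ENNReal.ofReal_le_ofReal ?_
  rw [segment_eq_image'] at hz
  obtain ⟨t, ht, rfl⟩ := hz
  rw [sub_add_cancel_left, norm_neg, norm_smul, Real.norm_of_nonneg ht.1]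
  exact mul_le_of_le_one_left (norm_nonneg _) ht.2

/-- Sublevel sets of suprema of real parts of entire functions are pseudoconvex. -/
theorem isPseudoconvex_setOf_iSup_re_lt {ι : Type*} {S : Set ι} {f : ι → X → ℂ}
    (hf : ∀ i ∈ S, Differentiable ℂ (f i)) {u : X → ℝ}
    (hu : ∀ x, IsLUB ((fun i => (f i x).re) '' S) (u x)) (husc : UpperSemicontinuous u) :
    IsPseudoconvex {x | u x < 0} := by
  set P := {x | u x < 0} with hP
  have hopen : IsOpen P := husc.isOpen_preimage 0
  have hpos : ∀ x ∈ P, infEDist x (frontier P) ≠ 0 := fun x hx h0 => by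
    rw [← mem_closure_iff_infEDist_zero, isClosed_frontier.closure_eq, hopen.frontier_eq] at h0
    exact h0.2 hx
  refine ⟨hopen, fun x hx => ?_, ?_, fun a b hab => ?_⟩
  · rw [lt_top_iff_ne_top, Ne, EReal.neg_eq_top_iff, ENNReal.log_eq_bot_iff]
    exact hpos x hx
  · exact (continuous_neg.comp
      (ENNReal.continuous_log.comp continuous_infEDist)).upperSemicontinuous.upperSemicontinuousOn _
  rcases (frontier P).eq_empty_or_nonempty with hemp | hne
  · simp [hemp]
  have hfin : ∀ x, infEDist x (frontier P) ≠ ⊤ := fun x => infEDist_ne_top hne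
  set d : X → ℝ := fun x => infDist x (frontier P) with hd
  have hdpos : ∀ x ∈ P, 0 < d x := fun x hx => ENNReal.toReal_pos (hpos x hx) (hfin x)
  have hdE : ∀ x, infEDist x (frontier P) = ENNReal.ofReal (d x) := fun x =>
    (ENNReal.ofReal_toReal (hfin x)).symm
  have hval : ∀ x ∈ P, -ENNReal.log (infEDist x (frontier P)) = ((-Real.log (d x) : ℝ) : EReal) :=
    fun x hx => by rw [hdE, ENNReal.log_ofReal_of_pos (hdpos x hx), EReal.coe_neg]
  have hsph : ∀ ζ ∈ sphere (0 : ℂ) 1, a + ζ • b ∈ P := fun ζ hζ => hab ζ (by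
    rw [mem_sphere_zero_iff_norm] at hζ; exact hζ.le)
  have haP : a ∈ P := by simpa using hab 0 (by simp)
  set g : ℂ → ℝ := fun ζ => -Real.log (d (a + ζ • b)) with hg
  have hgc : ContinuousOn g (sphere 0 1) := by
    refine (ContinuousOn.log ?_ fun ζ hζ => (hdpos _ (hsph ζ hζ)).ne').neg
    exact ((continuous_infDist_pt _).comp (by fun_prop)).continuousOn
  rw [circleMean_eq_circleAverage hgc fun ζ hζ => hval _ (hsph ζ hζ), hval a haP,
    EReal.coe_le_coe_iff]
  by_contra! hlt
  -- One `ε` pays for the value of `Re p` at the centre, the other for the shift in the radius `r`.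
  obtain ⟨ε, hε, hεlt⟩ : ∃ ε > 0, Real.circleAverage g 0 1 + 2 * ε < -Real.log (d a) :=
    ⟨(-Real.log (d a) - Real.circleAverage g 0 1) / 4, by linarith, by linarith⟩
  obtain ⟨p, hpd, hpg⟩ := exists_differentiable_re_near hgc hε
  have hp0 : (p 0).re ≤ Real.circleAverage g 0 1 + ε := by
    rw [← circleAverage_re hpd, ← Real.circleAverage_const ε 0 1,
      ← Real.circleAverage_fun_add (hgc.circleIntegrable zero_le_one)
        (circleIntegrable_const ε 0 1)]
    refine Real.circleAverage_mono (circleIntegrable_re hpd)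
      ((hgc.circleIntegrable zero_le_one).add (circleIntegrable_const ε 0 1)) fun z hz => ?_
    have := abs_lt.1 (hpg z (by simpa using hz))
    linarith
  -- The radius `r ζ = exp (-(p ζ + ε))` is at most `d` on the circle, but exceeds `d` at `0`.
  set r : ℂ → ℂ := fun ζ => Complex.exp (-(p ζ + ε)) with hr
  have hrd : Differentiable ℂ r := by fun_prop
  have hrn : ∀ ζ, ‖r ζ‖ = Real.exp (-((p ζ).re + ε)) := fun ζ => by
    simp [hr, Complex.norm_exp]
  have hr0 : d a < ‖r 0‖ := by
    rw [hrn, ← Real.exp_log (hdpos a haP), Real.exp_lt_exp]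
    linarith
  have hrs : ∀ ζ ∈ sphere (0 : ℂ) 1, ‖r ζ‖ ≤ d (a + ζ • b) := fun ζ hζ => by
    rw [hrn, ← Real.exp_log (hdpos _ (hsph ζ hζ)), Real.exp_le_exp]
    have := (abs_lt.1 (hpg ζ hζ)).2
    simp only [hg] at this
    linarith
  obtain ⟨z, hzf, hza⟩ := (infDist_lt_iff hne).1 hr0
  have hr0' : r 0 ≠ 0 := Complex.exp_ne_zero _
  -- This direction puts the centre of the disc `D` at the frontier point `z`; since `‖w‖ < 1`
  -- strictly, the boundary circle stays in `P`.
  set w : X := (r 0)⁻¹ • (z - a) with hw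
  have hw1 : ‖w‖ < 1 := by
    rw [hw, norm_smul, norm_inv, ← dist_eq_norm, dist_comm, inv_mul_lt_iff₀ (norm_pos_iff.2 hr0')]
    simpa using hza
  set D : ℂ → X := fun ζ => a + ζ • b + r ζ • w with hD
  have hDd : Differentiable ℂ D := by fun_prop
  have hD0 : D 0 = z := by simp [hD, hw, smul_inv_smul₀ hr0']
  have hDs : ∀ ζ ∈ sphere (0 : ℂ) 1, D ζ ∈ P := fun ζ hζ => by
    refine mem_of_ofReal_lt_infEDist_frontier hopen (hsph ζ hζ) ?_
    rw [hdE, ENNReal.ofReal_lt_ofReal_iff (hdpos _ (hsph ζ hζ)), hD, add_sub_cancel_left, norm_smul]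
    refine lt_of_lt_of_le ?_ (hrs ζ hζ)
    exact mul_lt_of_lt_one_right (norm_pos_iff.2 (Complex.exp_ne_zero _)) hw1
  -- The maximum is attained, so the bound on the circle is strictly negative; a mere supremum would
  -- only give `≤ 0`.
  obtain ⟨ζ₀, hζ₀, hmax⟩ := UpperSemicontinuousOn.exists_isMaxOn (s := sphere (0 : ℂ) 1)
    (f := fun ζ => u (D ζ)) ⟨1, by simp⟩ (isCompact_sphere 0 1)
    ((husc.comp hDd.continuous).upperSemicontinuousOn _)
  have hle : u z ≤ u (D ζ₀) := by
    refine (hu z).2 ?_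
    rintro _ ⟨i, hi, rfl⟩
    have := re_zero_le_of_sphere ((hf i hi).comp hDd) (M := u (D ζ₀)) fun ζ hζ =>
      ((hu (D ζ)).1 ⟨i, hi, rfl⟩).trans (hmax hζ)
    simpa [hD0] using this
  rw [hopen.frontier_eq] at hzf
  exact hzf.2 (hle.trans_lt (hDs ζ₀ hζ₀))

end Sublevel

/-! ### Weighted sums of squares of functionals. -/

theorem hasSum_inv_four_pow : HasSum (fun k : ℕ => ((4 : ℝ) ^ k)⁻¹) (4 / 3) := by
  have h := hasSum_geometric_of_lt_one (r := (4 : ℝ)⁻¹) (by norm_num) (by norm_num)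
  simp only [inv_pow] at h
  convert h using 1
  norm_num

section WeightedSquares

variable {X : Type*} [NormedAddCommGroup X] [NormedSpace ℂ X]

theorem norm_smulRight_inv_four_pow_smul_le (L : ℕ → X →L[ℂ] ℂ) {C : ℝ} (hL : ∀ k, ‖L k‖ ≤ C)
    (k : ℕ) : ‖(L k).smulRight (((4 : ℂ) ^ k)⁻¹ • L k)‖ ≤ ((4 : ℝ) ^ k)⁻¹ * (C * C) := by
  rw [ContinuousLinearMap.norm_smulRight_apply, norm_smul, norm_inv, norm_pow, RCLike.norm_ofNat,
    mul_left_comm]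
  have := (norm_nonneg _).trans (hL k)
  gcongr <;> exact hL k

theorem summable_smulRight_inv_four_pow_smul (L : ℕ → X →L[ℂ] ℂ) {C : ℝ}
    (hL : ∀ k, ‖L k‖ ≤ C) : Summable fun k => (L k).smulRight (((4 : ℂ) ^ k)⁻¹ • L k) := by
  apply Summable.of_norm_bounded (E := X →L[ℂ] X →L[ℂ] ℂ)
    (g := fun k => ((4 : ℝ) ^ k)⁻¹ * (C * C)) (hasSum_inv_four_pow.summable.mul_right _)
  exact norm_smulRight_inv_four_pow_smul_le L hL

theorem hasSum_bilinear_apply {T : ℕ → X →L[ℂ] X →L[ℂ] ℂ} {B : X →L[ℂ] X →L[ℂ] ℂ}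
    (h : HasSum T B) (x y : X) : HasSum (fun k => T k x y) (B x y) := by
  have h₁ : HasSum (fun k => T k x) (B x) := h.mapL (ContinuousLinearMap.apply ℂ (X →L[ℂ] ℂ) x)
  exact h₁.mapL (ContinuousLinearMap.apply ℂ ℂ y)

/-- A geometrically weighted sum of squares of bounded functionals is an entire function. -/
theorem exists_differentiable_hasSum_sq (L : ℕ → X →L[ℂ] ℂ) {C : ℝ} (hL : ∀ k, ‖L k‖ ≤ C) :
    ∃ φ : X → ℂ, Differentiable ℂ φ ∧
      ∀ x, HasSum (fun k : ℕ => ((4 : ℂ) ^ k)⁻¹ * L k x ^ 2) (φ x) := by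
  -- The rank-one bilinear forms sum in operator norm; the series is the diagonal of the bounded
  -- form `B`.
  obtain ⟨B, hB⟩ := summable_smulRight_inv_four_pow_smul L hL
  refine ⟨fun x => B x x, B.differentiable.clm_apply differentiable_id, fun x => ?_⟩
  have e : ∀ k, ((4 : ℂ) ^ k)⁻¹ * L k x ^ 2 =
      (L k).smulRight (((4 : ℂ) ^ k)⁻¹ • L k) x x := fun k => by
    simp only [ContinuousLinearMap.smulRight_apply, smul_apply, smul_eq_mul]
    ring
  simpa only [e] using hasSum_bilinear_apply hB x x

end WeightedSquares

/-! ### Estimates for `Re φ_b` on the complexification. -/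

namespace Complexification

section Algebra

variable {E : Type*} [AddCommGroup E]

@[simp] theorem sub_re (x y : Complexification E) : (x - y).re = x.re - y.re := by
  simp [sub_eq_add_neg]

@[simp] theorem sub_im (x y : Complexification E) : (x - y).im = x.im - y.im := by
  simp [sub_eq_add_neg]

@[simp] theorem ofReal_re (x : E) : (ofReal x).re = x := rfl

@[simp] theorem ofReal_im (x : E) : (ofReal x).im = 0 := rfl

end Algebra

variable {E : Type*} [NormedAddCommGroup E] [NormedSpace ℝ E]

theorem norm_re_le (x : Complexification E) : ‖x.re‖ ≤ ‖x‖ := by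
  simpa using norm_re_smul_le x 1

theorem norm_im_le (x : Complexification E) : ‖x.im‖ ≤ ‖x‖ := by
  simpa [Circle.coe_exp, Complex.exp_re, Complex.exp_im] using
    norm_re_smul_le x (Circle.exp (Real.pi / 2))

/-- `extend` as a continuous complex linear functional. -/
noncomputable def extendCLM (l : E →L[ℝ] ℝ) : Complexification E →L[ℂ] ℂ :=
  LinearMap.mkContinuous
    { toFun := extend l
      map_add' := fun x y => by simp [extend]; ring
      map_smul' := fun c x => by apply Complex.ext <;> simp [extend, add_comm] }
    (2 * ‖l‖) fun x => by
      change ‖extend l x‖ ≤ _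
      have h₁ := (l.le_opNorm x.re).trans
        (mul_le_mul_of_nonneg_left (norm_re_le x) (norm_nonneg l))
      have h₂ := (l.le_opNorm x.im).trans
        (mul_le_mul_of_nonneg_left (norm_im_le x) (norm_nonneg l))
      calc ‖extend l x‖ ≤ ‖(l x.re : ℂ)‖ + ‖Complex.I * (l x.im : ℂ)‖ := norm_add_le _ _
        _ = ‖l x.re‖ + ‖l x.im‖ := by simp
        _ ≤ 2 * ‖l‖ * ‖x‖ := by linarith

theorem norm_extendCLM_le (l : E →L[ℝ] ℝ) : ‖extendCLM l‖ ≤ 2 * ‖l‖ :=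
  LinearMap.mkContinuous_norm_le _ (by positivity) _

theorem re_extend_sq (l : E →L[ℝ] ℝ) (x : Complexification E) :
    (extend l x ^ 2).re = l x.re ^ 2 - l x.im ^ 2 := by
  simp [extend, pow_two]

section WeightedSquares

variable {l : ℕ → E → E →L[ℝ] ℝ} {φ : E → Complexification E → ℂ}

theorem hasSum_neg_re (hφ : ∀ b x, HasSum (fun k : ℕ => ((4 : ℂ) ^ k)⁻¹ *
      extend (l k b) (x - ofReal b) ^ 2) (φ b x)) (b : E) (x : Complexification E) :
    HasSum (fun k : ℕ => ((4 : ℝ) ^ k)⁻¹ * (l k b x.im ^ 2 - l k b (x.re - b) ^ 2))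
      (-(φ b x).re) := by
  have h := (Complex.hasSum_re (hφ b x)).neg
  have e : ∀ k : ℕ, ((4 : ℝ) ^ k)⁻¹ * (l k b x.im ^ 2 - l k b (x.re - b) ^ 2) =
      -(((4 : ℂ) ^ k)⁻¹ * extend (l k b) (x - ofReal b) ^ 2).re := fun k => by
    have e' : ((4 : ℂ) ^ k)⁻¹ = (((4 : ℝ) ^ k)⁻¹ : ℝ) := by push_cast; rfl
    rw [e', Complex.re_ofReal_mul, re_extend_sq]
    simp only [sub_re, sub_im, ofReal_re, ofReal_im, sub_zero]
    ring
  simpa only [e] using h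

theorem sq_apply_le {f : E →L[ℝ] ℝ} (hf : ‖f‖ ≤ 1) (v : E) : f v ^ 2 ≤ ‖v‖ ^ 2 := by
  rw [sq_le_sq, abs_norm]
  exact f.le_of_opNorm_le hf v |>.trans_eq (one_mul _)

/-- Only the imaginary part contributes positively, and its contribution is bounded independently of
`b`; this makes `u` finite. -/
theorem neg_re_le (hl : ∀ k b, ‖l k b‖ ≤ 1) (hφ : ∀ b x, HasSum (fun k : ℕ => ((4 : ℂ) ^ k)⁻¹ *
      extend (l k b) (x - ofReal b) ^ 2) (φ b x)) (b : E) (x : Complexification E) :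
    -(φ b x).re ≤ 4 / 3 * ‖x.im‖ ^ 2 := by
  refine hasSum_le (fun k => ?_) (hasSum_neg_re hφ b x) (hasSum_inv_four_pow.mul_right _)
  have := sq_apply_le (hl k b) x.im
  gcongr
  nlinarith [sq_nonneg (l k b (x.re - b))]

/-- In the application `q` is unbounded as `b` varies. The cross term is absorbed by `2|q|r ≤ r q² +
r`, which the factor `1 - r` leaves room for; the remainder is free of `q`. -/
theorem sq_sub_sq_le_of_abs_le {s t p q r M : ℝ} (hr : 0 ≤ r) (hs : |s| ≤ r) (ht : |t| ≤ r)
    (hp : |p| ≤ M) :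
    (p + s) ^ 2 - (q + t) ^ 2 ≤
      (1 - r) * (p ^ 2 - q ^ 2) + (r * M ^ 2 + 2 * M * r + r ^ 2 + r) := by
  have hM := (abs_nonneg p).trans hp
  have h1 : p * s ≤ M * r := (le_abs_self _).trans (by rw [abs_mul]; gcongr)
  have h2 : -(q * t) ≤ |q| * r := (neg_le_abs _).trans (by rw [abs_mul]; gcongr)
  have h3 : p ^ 2 ≤ M ^ 2 := sq_le_sq' (abs_le.1 hp).1 (abs_le.1 hp).2
  have h4 : s ^ 2 ≤ r ^ 2 := sq_le_sq' (abs_le.1 hs).1 (abs_le.1 hs).2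
  have h5 : 0 ≤ r * (|q| - 1) ^ 2 := by positivity
  have h6 := mul_le_mul_of_nonneg_left h3 hr
  nlinarith [sq_abs q, sq_nonneg t]

/-- A bound for the increments of `-Re φ_b` that is uniform in `b`. -/
theorem neg_re_le_of_dist_le (hl : ∀ k b, ‖l k b‖ ≤ 1)
    (hφ : ∀ b x, HasSum (fun k : ℕ => ((4 : ℂ) ^ k)⁻¹ *
      extend (l k b) (x - ofReal b) ^ 2) (φ b x)) (b : E) (x y : Complexification E) :
    -(φ b y).re ≤ (1 - ‖y - x‖) * -(φ b x).re +
      4 / 3 * (‖y - x‖ * ‖x‖ ^ 2 + 2 * ‖x‖ * ‖y - x‖ + ‖y - x‖ ^ 2 + ‖y - x‖) := by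
  refine hasSum_le (fun k => ?_) (hasSum_neg_re hφ b y)
    (((hasSum_neg_re hφ b x).mul_left _).add (hasSum_inv_four_pow.mul_right _))
  have hb : ∀ v : E, |l k b v| ≤ ‖v‖ := fun v =>
    ((l k b).le_of_opNorm_le (hl k b) v).trans_eq (one_mul _)
  have h := sq_sub_sq_le_of_abs_le (s := l k b (y - x).im) (t := l k b (y - x).re)
    (p := l k b x.im) (q := l k b (x.re - b)) (norm_nonneg (y - x))
    ((hb _).trans (norm_im_le _)) ((hb _).trans (norm_re_le _)) ((hb _).trans (norm_im_le x))
  rw [← map_add, ← map_add] at h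
  have e₁ : x.im + (y - x).im = y.im := by simp
  have e₂ : x.re - b + (y - x).re = y.re - b := by simp
  rw [e₁, e₂] at h
  have := mul_le_mul_of_nonneg_left h (by positivity : (0 : ℝ) ≤ ((4 : ℝ) ^ k)⁻¹)
  linarith

theorem upperSemicontinuous_of_isLUB (hl : ∀ k b, ‖l k b‖ ≤ 1)
    (hφ : ∀ b x, HasSum (fun k : ℕ => ((4 : ℂ) ^ k)⁻¹ *
      extend (l k b) (x - ofReal b) ^ 2) (φ b x)) {S : Set E} {u : Complexification E → ℝ}
    (hu : ∀ x, IsLUB ((fun b => -(φ b x).re) '' S) (u x)) : UpperSemicontinuous u := by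
  intro x c hc
  have hcont : Continuous fun y : Complexification E => (1 - ‖y - x‖) * u x +
      4 / 3 * (‖y - x‖ * ‖x‖ ^ 2 + 2 * ‖x‖ * ‖y - x‖ + ‖y - x‖ ^ 2 + ‖y - x‖) := by fun_prop
  have h₁ := (hcont.tendsto x).eventually_lt_const (u := c) (by simpa using hc)
  filter_upwards [h₁, Metric.ball_mem_nhds x one_pos] with y hy hyx
  refine lt_of_le_of_lt ((hu y).2 ?_) hy
  rintro _ ⟨b, hb, rfl⟩
  refine (neg_re_le_of_dist_le hl hφ b x y).trans ?_
  -- The unit ball keeps this factor nonnegative, so that `-Re φ_b(x)` may be replaced by `u x`.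
  have hyx' : 0 ≤ 1 - ‖y - x‖ := by
    rw [mem_ball, dist_eq_norm] at hyx; linarith
  have := (hu x).1 ⟨b, hb, rfl⟩
  dsimp only at this
  gcongr

end WeightedSquares

/-- On a real point at distance at least `δ` from `b`, one term already makes `Re φ_b` positive. -/
theorem neg_re_ofReal_le {l : ℕ → E → E →L[ℝ] ℝ} {φ : E → Complexification E → ℂ}
    (hl : ∀ k b, ‖l k b‖ ≤ 1) (hφ : ∀ b x, HasSum (fun k : ℕ => ((4 : ℂ) ^ k)⁻¹ *
      extend (l k b) (x - ofReal b) ^ 2) (φ b x)) {a x b : E} {k : ℕ} {δ : ℝ} (hδ : 0 ≤ δ)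
    (hab : l k b (a - b) = ‖a - b‖) (hxb : 4 * δ ≤ ‖x - b‖) (hxa : ‖x - a‖ ≤ δ) :
    -(φ b (ofReal x)).re ≤ -(((4 : ℝ) ^ k)⁻¹ * δ ^ 2) := by
  have h : HasSum (fun j : ℕ => ((4 : ℝ) ^ j)⁻¹ * l j b (x - b) ^ 2) (φ b (ofReal x)).re := by
    have := (hasSum_neg_re hφ b (ofReal x)).neg
    simpa using this
  have h₁ := le_hasSum h k fun j _ => by positivity
  have h₂ : l k b (x - b) = l k b (a - b) + l k b (x - a) := by rw [← map_add]; congr 1; abel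
  have h₃ : |l k b (x - a)| ≤ ‖x - a‖ :=
    ((l k b).le_of_opNorm_le (hl k b) _).trans_eq (one_mul _)
  have h₄ : ‖x - b‖ ≤ ‖x - a‖ + ‖a - b‖ := norm_sub_le_norm_sub_add_norm_sub _ _ _
  -- Here `‖a - b‖ ≥ 3δ`, and moving from `a` to `x` costs at most `δ`.
  have h₅ : δ ≤ l k b (x - b) := by
    rw [h₂, hab]
    linarith [neg_le_of_abs_le h₃]
  refine neg_le_neg (le_trans ?_ h₁)
  gcongr

end Complexification

/-! ### Trivial cases and the construction of `P`. -/

theorem isPseudoconvex_empty {X : Type*} [NormedAddCommGroup X] [NormedSpace ℂ X] :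
    IsPseudoconvex (∅ : Set X) :=
  ⟨isOpen_empty, by simp, fun x hx => hx.elim, fun a b h => (h 0 (by simp)).elim⟩

theorem isPseudoconvex_univ {X : Type*} [NormedAddCommGroup X] [NormedSpace ℂ X] :
    IsPseudoconvex (univ : Set X) :=
  ⟨isOpen_univ, by simp, by
    simpa using upperSemicontinuous_const.upperSemicontinuousOn _, by simp⟩

open Complexification in
theorem mainTheorem5 {E : Type*} [NormedAddCommGroup E] [NormedSpace ℝ E] [CompleteSpace E]
    [TopologicalSpace.SeparableSpace E] (Ω : Set E) (hΩ : IsOpen Ω) :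
    ∃ P : Set (Complexification E),
      IsPseudoconvex P ∧
      P ∩ Set.range Complexification.ofReal = Complexification.ofReal '' Ω ∧
      (Ω.Nonempty → Ω ≠ Set.univ →
        ∃ (a : ℕ → E) (l : ℕ → E → (E →L[ℝ] ℝ)) (φ : E → Complexification E → ℂ)
          (u : Complexification E → ℝ),
          (∀ k, a k ∈ Ω) ∧ Ω ⊆ closure (Set.range a) ∧
          (∀ k, ∀ b ∈ Ωᶜ, ‖l k b‖ = 1 ∧ l k b (a k - b) = ‖a k - b‖) ∧
          (∀ b ∈ Ωᶜ, Differentiable ℂ (φ b) ∧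
            ∀ x, HasSum (fun k : ℕ => ((4 : ℂ) ^ k)⁻¹ *
              Complexification.extend (l k b) (x - Complexification.ofReal b) ^ 2) (φ b x)) ∧
          (∀ x, IsLUB ((fun b => -(φ b x).re) '' Ωᶜ) (u x)) ∧
          P = {x | u x < 0}) := by
  rcases Ω.eq_empty_or_nonempty with rfl | hne
  · exact ⟨∅, isPseudoconvex_empty, by simp, fun h => absurd h Set.not_nonempty_empty⟩
  by_cases huniv : Ω = Set.univ
  · subst huniv
    exact ⟨Set.univ, isPseudoconvex_univ, by simp, fun _ h => absurd rfl h⟩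
  have hcne : Ωᶜ.Nonempty := Set.nonempty_compl.2 huniv
  have := hne.to_subtype
  set a : ℕ → E := fun k => TopologicalSpace.denseSeq Ω k with ha
  have haΩ : ∀ k, a k ∈ Ω := fun k => (TopologicalSpace.denseSeq Ω k).2
  have hdense : Ω ⊆ closure (Set.range a) := fun x hx => by
    have h := image_closure_subset_closure_image continuous_subtype_val
      ⟨_, TopologicalSpace.denseRange_denseSeq Ω ⟨x, hx⟩, rfl⟩
    rwa [← Set.range_comp] at h
  -- For `b ∈ Ω` the functional is set to `0`, so the norm bound, and with it every estimate, holds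
  -- for all `b`.
  have hdual : ∀ (k : ℕ) (b : E), ∃ g : E →L[ℝ] ℝ, ‖g‖ ≤ 1 ∧
      (b ∈ Ωᶜ → ‖g‖ = 1 ∧ g (a k - b) = ‖a k - b‖) := fun k b => by
    by_cases hb : b ∈ Ωᶜ
    · have hab : ‖a k - b‖ ≠ 0 := fun h =>
        hb (sub_eq_zero.1 (norm_eq_zero.1 h) ▸ haΩ k)
      obtain ⟨g, hg, hga⟩ := exists_dual_vector ℝ (a k - b) hab
      exact ⟨g, hg.le, fun _ => ⟨hg, hga⟩⟩
    · exact ⟨0, by simp, fun h => absurd h hb⟩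
  choose l hl hlb using hdual
  have hentire : ∀ b, ∃ φ : Complexification E → ℂ, Differentiable ℂ φ ∧
      ∀ x, HasSum (fun k : ℕ => ((4 : ℂ) ^ k)⁻¹ * extend (l k b) (x - ofReal b) ^ 2) (φ x) := by
    intro b
    obtain ⟨ψ, hψd, hψ⟩ := exists_differentiable_hasSum_sq (fun k => extendCLM (l k b)) (C := 2)
      fun k => (norm_extendCLM_le _).trans (by linarith [hl k b])
    exact ⟨fun x => ψ (x - ofReal b), by fun_prop, fun x => hψ _⟩
  choose φ hφd hφ using hentire
  have hbdd : ∀ x, BddAbove ((fun b => -(φ b x).re) '' Ωᶜ) := fun x =>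
    ⟨_, Set.forall_mem_image.2 fun b _ => neg_re_le hl hφ b x⟩
  set u : Complexification E → ℝ := fun x => sSup ((fun b => -(φ b x).re) '' Ωᶜ) with hudef
  have hu : ∀ x, IsLUB ((fun b => -(φ b x).re) '' Ωᶜ) (u x) := fun x =>
    isLUB_csSup (hcne.image _) (hbdd x)
  refine ⟨{x | u x < 0}, ?_, ?_, fun _ _ =>
    ⟨a, l, φ, u, haΩ, hdense, hlb, fun b _ => ⟨hφd b, hφ b⟩, hu, rfl⟩⟩
  · exact isPseudoconvex_setOf_iSup_re_lt (f := fun b x => -φ b x) (fun b _ => (hφd b).neg)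
      (by simpa using hu) (upperSemicontinuous_of_isLUB hl hφ hu)
  ext z
  constructor
  · rintro ⟨hz, x, rfl⟩
    refine ⟨x, ?_, rfl⟩
    by_contra hx
    have h₀ : -(φ x (ofReal x)).re = 0 :=
      (hasSum_neg_re hφ x (ofReal x)).unique (by simp)
    have h₁ := (hu (ofReal x)).1 ⟨x, hx, rfl⟩
    simp only [h₀] at h₁
    exact absurd hz (not_lt.2 h₁)
  · rintro ⟨x, hx, rfl⟩
    refine ⟨?_, x, rfl⟩
    obtain ⟨r, hr, hball⟩ := Metric.isOpen_iff.1 hΩ x hx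
    obtain ⟨_, ⟨k, rfl⟩, hk⟩ := Metric.mem_closure_iff.1 (hdense hx) (r / 4) (by positivity)
    rw [dist_eq_norm] at hk
    -- The index `k` was fixed before `b`, so the bound survives the supremum and stays strictly
    -- negative.
    have h : u (ofReal x) ≤ -(((4 : ℝ) ^ k)⁻¹ * (r / 4) ^ 2) := by
      refine (hu (ofReal x)).2 (Set.forall_mem_image.2 fun b hb => ?_)
      refine neg_re_ofReal_le hl hφ (by positivity) (hlb k b hb).2 ?_ hk.le
      by_contra! hlt
      refine hb (hball ?_)
      rw [Metric.mem_ball, dist_comm, dist_eq_norm]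
      linarith
    refine h.trans_lt (neg_lt_zero.2 ?_)
    positivity
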